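/- Conventions. A topological $*$-algebra is a (not necessarily unital) associative complex algebra $A$ with a conjugate-linear involution satisfying $(ab)^*=b^*a^*$ and a topology making addition, additive inverse, multiplication and involution jointly continuous. $\mathsf{T^*A}$ is the category of these algebras and continuous $*$-homomorphisms; subobjects are $*$-subalgebras with the subspace topology. A $*$-representation of $A$ is a continuous $*$-homomorphism $A\to B(H)$ into the bounded operators (norm topology) on a Hilbert space; $\mathcal T_A$ is the initial topology on $A$ with respect to all $*$-representations, and $c^*_A(S)$ denotes the $\mathcal T_A$-closure of a $*$-subalgebra $S\subseteq A$. The reducing ideal is $A_R=c^*_A(\{0\})$. $\mathsf{P^*A}$ is the full subcategory of those $A$ whose topology equals $\mathcal T_A$ and for which $A_R=0$. A continuous $C^*$-seminorm on $A$ is a continuous seminorm $p$ with $p(ab)\le p(a)p(b)$ and $p(a^*a)=p(a)^2$; $\mathcal N(A)$ is the set of these, ordered pointwise, $A_p$ is the completion of $A/\ker p$ in the norm induced by $p$. Put $\overline{PC^*}(A)=\lim_{p\in\mathcal N(A)}A_p$ (limit in $\mathsf{T^*A}$, along the canonical morphisms $A_q\to A_p$ for $p\le q$), $\eta_A\colon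 A\to\overline{PC^*}(A)$, $a\mapsto(a+\ker p)_p$, let $PC^*(A)=\eta_A(A)$ with the subspace topology, and let $\alpha_A\colon A\to PC^*(A)$ be $\eta_A$ with restricted codomain. A morphism $\varphi\colon A\to B$ induces $\overline{PC^*}(\varphi)\colon(x_p)_p\mapsto(\varphi_r(x_{r\circ\varphi}))_{r\in\mathcal N(B)}$, where $\varphi_r\colon A_{r\circ\varphi}\to B_r$ is induced by $\varphi$, and $PC^*(\varphi)$ is its restriction to $PC^*(A)\to PC^*(B)$. $K$ denotes the Kuratowski (topological) closure. For a $*$-subalgebra $m\colon S\hookrightarrow A$, the initial lifts of $K$ are $$K^\alpha_A(S)=\alpha_A^{-1}\bigl(K(\operatorname{im}PC^*(m))\bigr),\qquad K^\eta_A(S)=\eta_A^{-1}\bigl(K(\overline{\operatorname{im}\overline{PC^*}(m)})\bigr),$$ the images being taken with respect to the (surjection, embedding) factorization in $\mathsf{P^*A}$ and the (dense image, closed embedding) factorization for pro-$C^*$-algebras, respectively. $A$ is $c^*$-separated if the diagonal of $A\times A$ is $c^*$-closed. $A$ is $c^*$-compact if $\pi_B(c^*_{A\times B}(S))=c^*_B(\pi_B(S))$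 for every $B\in\mathsf{T^*A}$ and every $*$-subalgebra $S\subseteq A\times B$, where $\pi_B\colon A\times B\to B$ is the projection. An object $A$ of $\mathsf{P^*A}$ is $K$-compact in $\mathsf{P^*A}$ if $\pi_B(\overline S)=\overline{\pi_B(S)}$ for every $B\in\mathsf{P^*A}$ and every $*$-subalgebra $S\subseteq A\times B$. Theorem. (a) $c^*=K^\alpha=K^\eta$: for every $A\in\mathsf{T^*A}$ and every $*$-subalgebra $S\subseteq A$, $c^*_A(S)=K^\alpha_A(S)=K^\eta_A(S)$. (b) $c^*$ is finitely productive: for every finite family $(A_i)_{i\in I}$ in $\mathsf{T^*A}$ and $*$-subalgebras $S_i\subseteq A_i$, $c^*_{\prod A_i}(\prod S_i)=\prod c^*_{A_i}(S_i)$. (c) $A\in\mathsf{T^*A}$ is $c^*$-separated if and only if $\alpha_A$ is injective, if and only if $A_R=0$; in particular, every algebra in $\mathsf{P^*A}$ is $c^*$-separated. (d) $A\in\mathsf{T^*A}$ is $c^*$-compact if and only if $PC^*(A)$ is $K$-compact in $\mathsf{P^*A}$; in this case $\eta_A$ is surjective. -/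

import Mathlib

universe u

namespace TopStarAlg

open UniformSpace Topology

noncomputable section

/-! A topological `*`-algebra is a (not necessarily unital) associative complex algebra `A` with a
conjugate-linear involution and a topology for which addition, negation, multiplication and
involution are continuous; this is expressed by the bundle of instance arguments
`[NonUnitalRing A] [StarRing A] [Module ℂ A] [IsScalarTower ℂ A A] [SMulCommClass ℂ A A]
[StarModule ℂ A] [TopologicalSpace A] [IsTopologicalRing A] [ContinuousStar A]`.
Morphisms are the continuous `*`-homomorphisms, subobjects are the `*`-subalgebras with the
subspace topology. -/

instance subalgebraContinuousStar {A : Type u} [NonUnitalRing A] [StarRing A] [Module ℂ A]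
    [TopologicalSpace A] [ContinuousStar A] (S : NonUnitalStarSubalgebra ℂ A) :
    ContinuousStar S where
  continuous_star := by
    refine Continuous.subtype_mk (continuous_star.comp continuous_subtype_val) _

section InitialTopology

variable {A : Type u} [NonUnitalRing A] [StarRing A] [Module ℂ A] {ι : Type*} {B : ι → Type*}
  [∀ i, NonUnitalCStarAlgebra (B i)] (f : ∀ i, A →⋆ₙₐ[ℂ] B i)

/-- The initial topology with respect to a family of `*`-homomorphisms into `C*`-algebras. -/
abbrev initialTopology : TopologicalSpace A :=
  ⨅ i, TopologicalSpace.induced (f i) inferInstance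

theorem continuous_initialTopology (i : ι) : @Continuous A (B i) (initialTopology f) _ (f i) :=
  continuous_iff_le_induced.2 (iInf_le _ i)

theorem continuous_to_initialTopology {X : Type*} [TopologicalSpace X] {g : X → A}
    (h : ∀ i, Continuous fun x => f i (g x)) : @Continuous X A _ (initialTopology f) g :=
  continuous_iInf_rng.2 fun i => continuous_induced_rng.2 (h i)

theorem initialTopology_isTopologicalRing : @IsTopologicalRing A (initialTopology f) _ := by
  let _ := initialTopology f
  have hc := continuous_initialTopology f
  exact
    { continuous_add := continuous_to_initialTopology f fun i => by
        simp only [map_add]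
        exact ((hc i).comp continuous_fst).add ((hc i).comp continuous_snd)
      continuous_mul := continuous_to_initialTopology f fun i => by
        simp only [map_mul]
        exact ((hc i).comp continuous_fst).mul ((hc i).comp continuous_snd)
      continuous_neg := continuous_to_initialTopology f fun i => by
        simp only [map_neg]
        exact (hc i).neg }

theorem initialTopology_continuousStar : @ContinuousStar A (initialTopology f) _ := by
  let _ := initialTopology f
  exact ⟨continuous_to_initialTopology f fun i => by
    simpa [map_star] using (continuous_initialTopology f i).star⟩

theorem initialTopology_continuousConstSMul :
    @ContinuousConstSMul ℂ A (initialTopology f) _ := by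
  let _ := initialTopology f
  exact ⟨fun c => continuous_to_initialTopology f fun i => by
    simp only [map_smul]
    exact (continuous_initialTopology f i).const_smul c⟩

/-- The closure of a `*`-subalgebra in the initial topology. -/
def initialClosure (S : NonUnitalStarSubalgebra ℂ A) : NonUnitalStarSubalgebra ℂ A :=
  letI : TopologicalSpace A := initialTopology f
  haveI : IsTopologicalRing A := initialTopology_isTopologicalRing f
  haveI : ContinuousStar A := initialTopology_continuousStar f
  haveI : ContinuousConstSMul ℂ A := initialTopology_continuousConstSMul f
  S.topologicalClosure

end InitialTopology

section Representations

variable (A : Type u) [NonUnitalRing A] [StarRing A] [Module ℂ A] [TopologicalSpace A]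

/-- A `*`-representation: a continuous `*`-homomorphism into the bounded operators (with the norm
topology) on a Hilbert space. -/
structure Representation where
  /-- the Hilbert space -/
  H : Type u
  [normed : NormedAddCommGroup H]
  [inner : InnerProductSpace ℂ H]
  [complete : CompleteSpace H]
  /-- the underlying `*`-homomorphism -/
  hom : A →⋆ₙₐ[ℂ] (H →L[ℂ] H)
  continuous_hom : Continuous hom

attribute [instance] Representation.normed Representation.inner Representation.complete

/-- The `*`-representation topology: the initial topology with respect to all
`*`-representations. -/
abbrev repTopology : TopologicalSpace A :=
  initialTopology fun π : Representation A => π.hom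

variable {A}

/-- The closure operator `c^*`: the closure of a `*`-subalgebra in the `*`-representation
topology. -/
def cStar (S : NonUnitalStarSubalgebra ℂ A) : NonUnitalStarSubalgebra ℂ A :=
  initialClosure (fun π : Representation A => π.hom) S

theorem coe_cStar (S : NonUnitalStarSubalgebra ℂ A) :
    (cStar S : Set A) = @closure A (repTopology A) S := rfl

/-- The trivial `*`-subalgebra `{0}`. -/
def zeroSubalgebra (A : Type u) [NonUnitalRing A] [StarRing A] [Module ℂ A] :
    NonUnitalStarSubalgebra ℂ A where
  carrier := {0}
  add_mem' := by simp
  zero_mem' := by simp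
  mul_mem' := by simp
  smul_mem' := by simp
  star_mem' := by simp

/-- The reducing ideal `A_R = c^*({0})`. -/
def reducingIdeal (A : Type u) [NonUnitalRing A] [StarRing A] [Module ℂ A] [TopologicalSpace A] :
    NonUnitalStarSubalgebra ℂ A :=
  cStar (zeroSubalgebra A)

/-- The objects of the category `P*A`: the topology is the `*`-representation topology and the
reducing ideal is zero. -/
def IsPStar (A : Type u) [NonUnitalRing A] [StarRing A] [Module ℂ A] [t : TopologicalSpace A] :
    Prop :=
  t = repTopology A ∧ reducingIdeal A = zeroSubalgebra A

end Representations

section Seminorms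

/-- A continuous `C*`-seminorm on a topological `*`-algebra. -/
structure CStarSeminorm (A : Type u) [NonUnitalRing A] [StarRing A] [Module ℂ A]
    [TopologicalSpace A] extends Seminorm ℂ A where
  mul_le' : ∀ a b, toFun (a * b) ≤ toFun a * toFun b
  star_mul_self' : ∀ a, toFun (star a * a) = toFun a ^ 2
  continuous' : Continuous toFun

variable {A : Type u} [NonUnitalRing A] [StarRing A] [Module ℂ A] [TopologicalSpace A]
variable {B : Type u} [NonUnitalRing B] [StarRing B] [Module ℂ B] [TopologicalSpace B]

instance : CoeFun (CStarSeminorm A) fun _ => A → ℝ := ⟨fun p => p.toFun⟩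

instance : LE (CStarSeminorm A) := ⟨fun p q => ∀ a, p a ≤ q a⟩

theorem CStarSeminorm.nonneg (p : CStarSeminorm A) (a : A) : 0 ≤ p a :=
  apply_nonneg p.toSeminorm a

theorem CStarSeminorm.le_star (p : CStarSeminorm A) (a : A) : p a ≤ p (star a) := by
  rcases (p.nonneg a).eq_or_lt with h | h
  · rw [← h]; exact p.nonneg _
  · have h1 := p.star_mul_self' a
    have h2 := p.mul_le' (star a) a
    nlinarith

theorem CStarSeminorm.star_eq (p : CStarSeminorm A) (a : A) : p (star a) = p a :=
  le_antisymm (by simpa using p.le_star (star a)) (p.le_star a)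

/-- The pull-back `r ∘ φ` of a continuous `C*`-seminorm along a morphism. -/
def CStarSeminorm.comap (r : CStarSeminorm B) (φ : A →⋆ₙₐ[ℂ] B) (hφ : Continuous φ) :
    CStarSeminorm A where
  toFun a := r (φ a)
  map_zero' := by rw [map_zero]; exact r.map_zero'
  add_le' a b := by rw [map_add]; exact r.add_le' _ _
  neg' a := by rw [map_neg]; exact r.neg' _
  smul' c a := by rw [map_smul]; exact r.smul' _ _
  mul_le' a b := by rw [map_mul]; exact r.mul_le' _ _
  star_mul_self' a := by rw [map_mul, map_star]; exact r.star_mul_self' _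
  continuous' := r.continuous'.comp hφ

/-- The algebra `A` regarded as a seminormed algebra through the seminorm `p`. -/
@[nolint unusedArguments]
def WithSeminorm (_p : CStarSeminorm A) : Type u := A

namespace WithSeminorm

variable (p : CStarSeminorm A)

instance : NonUnitalRing (WithSeminorm p) := inferInstanceAs (NonUnitalRing A)
instance : StarRing (WithSeminorm p) := inferInstanceAs (StarRing A)
instance : Module ℂ (WithSeminorm p) := inferInstanceAs (Module ℂ A)
instance [h : IsScalarTower ℂ A A] : IsScalarTower ℂ (WithSeminorm p) (WithSeminorm p) := h
instance [h : SMulCommClass ℂ A A] : SMulCommClass ℂ (WithSeminorm p) (WithSeminorm p) := h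
instance [h : StarModule ℂ A] : StarModule ℂ (WithSeminorm p) := h

/-- The identity map of `A` as a map into the seminormed algebra. -/
def of (p : CStarSeminorm A) : A →⋆ₙₐ[ℂ] WithSeminorm p := NonUnitalStarAlgHom.id ℂ A

/-- The identity map of `A` as a map from the seminormed algebra. -/
def out (p : CStarSeminorm A) : WithSeminorm p →⋆ₙₐ[ℂ] A := NonUnitalStarAlgHom.id ℂ A

instance : SeminormedAddCommGroup (WithSeminorm p) :=
  AddGroupSeminorm.toSeminormedAddCommGroup (E := WithSeminorm p) p.toAddGroupSeminorm

theorem norm_of (a : A) : ‖of p a‖ = p a := rfl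

instance : NonUnitalSeminormedRing (WithSeminorm p) where
  __ := (inferInstance : SeminormedAddCommGroup (WithSeminorm p))
  __ := (inferInstance : NonUnitalRing (WithSeminorm p))
  norm_mul_le := p.mul_le'

instance : NormedSpace ℂ (WithSeminorm p) where
  norm_smul_le c a := (p.smul' c a).le

theorem norm_star (x : WithSeminorm p) : ‖star x‖ = ‖x‖ := p.star_eq x

end WithSeminorm

/-- The `C*`-algebra `A_p`: the (Hausdorff) completion of `A` with respect to the seminorm `p`,
that is, the completion of `A / ker p` with respect to the norm induced by `p`. -/
abbrev Compl (p : CStarSeminorm A) : Type u := Completion (WithSeminorm p)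

namespace Compl

open UniformSpace.Completion

variable (p : CStarSeminorm A)

instance : Mul (Compl p) :=
  ⟨Function.curry <| (isDenseInducing_coe.prodMap isDenseInducing_coe).extend
    ((↑) ∘ Function.uncurry (· * ·))⟩

theorem coe_mul (a b : WithSeminorm p) : ((a * b : WithSeminorm p) : Compl p) = a * b :=
  ((isDenseInducing_coe.prodMap isDenseInducing_coe).extend_eq
    ((continuous_coe _).comp continuous_mul) (a, b)).symm

instance : ContinuousMul (Compl p) where
  continuous_mul := by
    let m := (AddMonoidHom.mul : WithSeminorm p →+ WithSeminorm p →+ WithSeminorm p).compr₂ toCompl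
    have : Continuous fun x : WithSeminorm p × WithSeminorm p => m x.1 x.2 :=
      (continuous_coe _).comp continuous_mul
    have di : IsDenseInducing (toCompl : WithSeminorm p → Compl p) := isDenseInducing_coe
    exact (di.extend_Z_bilin di this :)

instance : Star (Compl p) := ⟨Completion.map star⟩

theorem uniformContinuous_star : UniformContinuous (star : WithSeminorm p → WithSeminorm p) :=
  (AddMonoidHomClass.isometry_of_norm (starAddEquiv : WithSeminorm p ≃+ WithSeminorm p)
    (WithSeminorm.norm_star p)).uniformContinuous

theorem coe_star (a : WithSeminorm p) : ((star a : WithSeminorm p) : Compl p) = star (a : Compl p) :=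
  (map_coe (uniformContinuous_star p) a).symm

instance : ContinuousStar (Compl p) := ⟨continuous_map⟩

instance : NonUnitalRing (Compl p) :=
  { (inferInstance : AddCommGroup (Compl p)), (inferInstance : Mul (Compl p)) with
    zero_mul a :=
      Completion.induction_on a (isClosed_eq (by fun_prop) continuous_const)
        fun a => by rw [← coe_zero, ← coe_mul, zero_mul]
    mul_zero a :=
      Completion.induction_on a (isClosed_eq (by fun_prop) continuous_const)
        fun a => by rw [← coe_zero, ← coe_mul, mul_zero]
    mul_assoc a b c :=
      Completion.induction_on₃ a b c (isClosed_eq (by fun_prop) (by fun_prop))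
        fun a b c => by rw [← coe_mul, ← coe_mul, ← coe_mul, ← coe_mul, mul_assoc]
    left_distrib a b c :=
      Completion.induction_on₃ a b c (isClosed_eq (by fun_prop) (by fun_prop))
        fun a b c => by rw [← coe_add, ← coe_mul, ← coe_mul, ← coe_mul, ← coe_add, mul_add]
    right_distrib a b c :=
      Completion.induction_on₃ a b c (isClosed_eq (by fun_prop) (by fun_prop))
        fun a b c => by rw [← coe_add, ← coe_mul, ← coe_mul, ← coe_mul, ← coe_add, add_mul] }

instance : StarRing (Compl p) where
  star_involutive a :=
    Completion.induction_on a (isClosed_eq (by fun_prop) (by fun_prop))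
      fun a => by rw [← coe_star, ← coe_star, star_star]
  star_mul a b :=
    Completion.induction_on₂ a b (isClosed_eq (by fun_prop) (by fun_prop))
      fun a b => by rw [← coe_mul, ← coe_star, ← coe_star, ← coe_star, ← coe_mul, star_mul]
  star_add a b :=
    Completion.induction_on₂ a b (isClosed_eq (by fun_prop) (by fun_prop))
      fun a b => by rw [← coe_add, ← coe_star, ← coe_star, ← coe_star, ← coe_add, star_add]

instance : NonUnitalNormedRing (Compl p) where
  __ := (inferInstance : NormedAddCommGroup (Compl p))
  __ := (inferInstance : NonUnitalRing (Compl p))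
  norm_mul_le x y := by
    induction x, y using induction_on₂ with
    | hp => exact isClosed_le (by fun_prop) (by fun_prop)
    | ih x y => simpa only [← coe_mul, norm_coe] using norm_mul_le x y

instance : CStarRing (Compl p) where
  norm_mul_self_le x := by
    induction x using induction_on with
    | hp => exact isClosed_le (by fun_prop) (by fun_prop)
    | ih x =>
      rw [← coe_star, ← coe_mul, norm_coe, norm_coe, ← sq]
      exact (p.star_mul_self' x).ge

instance [StarModule ℂ A] : StarModule ℂ (Compl p) where
  star_smul c x :=
    Completion.induction_on x
      (isClosed_eq (continuous_star.comp (continuous_const_smul c))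
        (continuous_star.const_smul (star c)))
      fun x => by rw [← coe_smul, ← coe_star, ← coe_star, ← coe_smul, star_smul]

instance [IsScalarTower ℂ A A] : IsScalarTower ℂ (Compl p) (Compl p) where
  smul_assoc c x y :=
    Completion.induction_on₂ x y
      (isClosed_eq ((continuous_fst.const_smul c).mul continuous_snd)
        ((continuous_fst.mul continuous_snd).const_smul c))
      fun x y => by
        rw [← coe_smul, smul_eq_mul, smul_eq_mul, ← coe_mul, ← coe_mul, ← coe_smul, smul_mul_assoc]

instance [SMulCommClass ℂ A A] : SMulCommClass ℂ (Compl p) (Compl p) where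
  smul_comm c x y :=
    Completion.induction_on₂ x y
      (isClosed_eq ((continuous_fst.mul continuous_snd).const_smul c)
        (continuous_fst.mul (continuous_snd.const_smul c)))
      fun x y => by
        rw [← coe_smul, smul_eq_mul, smul_eq_mul, ← coe_mul, ← coe_mul, ← coe_smul, mul_smul_comm]

instance [IsScalarTower ℂ A A] [SMulCommClass ℂ A A] [StarModule ℂ A] :
    NonUnitalCStarAlgebra (Compl p) where

/-- The canonical `*`-homomorphism `A → A_p`. -/
def coeHom : A →⋆ₙₐ[ℂ] Compl p where
  toFun a := (WithSeminorm.of p a : Compl p)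
  map_smul' c a := by rw [map_smul, coe_smul, MonoidHom.id_apply]
  map_zero' := by rw [map_zero, coe_zero]
  map_add' a b := by rw [map_add, coe_add]
  map_mul' a b := by rw [map_mul, coe_mul]
  map_star' a := by rw [map_star, coe_star]

variable {p}

/-- The `*`-homomorphism `A_q → B_r` induced by `φ : A → B` if `r ∘ φ ≤ q`. -/
def map {q : CStarSeminorm A} {r : CStarSeminorm B} (φ : A →⋆ₙₐ[ℂ] B) (h : ∀ a, r (φ a) ≤ q a) :
    Compl q →⋆ₙₐ[ℂ] Compl r :=
  let f : WithSeminorm q →⋆ₙₐ[ℂ] WithSeminorm r :=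
    (WithSeminorm.of r).comp (φ.comp (WithSeminorm.out q))
  have hf : UniformContinuous f :=
    (AddMonoidHomClass.lipschitz_of_bound f 1 fun a => by
      rw [one_mul]; exact h a).uniformContinuous
  have hc (a : WithSeminorm q) : Completion.map f (a : Compl q) = (f a : Compl r) := map_coe hf a
  have hm : Continuous (Completion.map f) := Completion.continuous_map
  { toFun := Completion.map f
    map_smul' c x := by
      refine Completion.induction_on x (isClosed_eq (hm.comp (continuous_const_smul c))
        (hm.const_smul c)) fun a => ?_
      rw [← coe_smul, hc, hc, map_smul, coe_smul, MonoidHom.id_apply]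
    map_zero' := by rw [← coe_zero, hc, map_zero, coe_zero]
    map_add' x y := by
      refine Completion.induction_on₂ x y (isClosed_eq (by fun_prop) (by fun_prop)) fun a b => ?_
      rw [← coe_add, hc, hc, hc, map_add, coe_add]
    map_mul' x y := by
      refine Completion.induction_on₂ x y (isClosed_eq (by fun_prop) (by fun_prop)) fun a b => ?_
      rw [← coe_mul, hc, hc, hc, map_mul, coe_mul]
    map_star' x := by
      refine Completion.induction_on x (isClosed_eq (by fun_prop) (by fun_prop)) fun a => ?_
      rw [← coe_star, hc, hc, map_star, coe_star] }

theorem continuous_map {q : CStarSeminorm A} {r : CStarSeminorm B} (φ : A →⋆ₙₐ[ℂ] B)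
    (h : ∀ a, r (φ a) ≤ q a) : Continuous (map φ h) :=
  Completion.continuous_map

theorem map_coeHom {q : CStarSeminorm A} {r : CStarSeminorm B} (φ : A →⋆ₙₐ[ℂ] B)
    (h : ∀ a, r (φ a) ≤ q a) (a : A) : map φ h (coeHom q a) = coeHom r (φ a) :=
  Completion.map_coe (AddMonoidHomClass.lipschitz_of_bound
    ((WithSeminorm.of r).comp (φ.comp (WithSeminorm.out q))) 1 fun a => by
      rw [one_mul]; exact h a).uniformContinuous _

theorem continuous_coeHom [IsTopologicalRing A] (p : CStarSeminorm A) : Continuous (coeHom p) := by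
  refine (continuous_coe _).comp (continuous_iff_continuousAt.2 fun a => ?_)
  rw [ContinuousAt, tendsto_iff_norm_sub_tendsto_zero]
  have h : Continuous fun x : A => p (x - a) := p.continuous'.comp (continuous_id.sub continuous_const)
  have h0 : p (a - a) = 0 := by rw [sub_self]; exact p.map_zero'
  exact h0 ▸ h.tendsto a

/-- Two continuous maps on `A_p` agree if they agree on the image of `A`. -/
theorem ext_coeHom {X : Type*} [TopologicalSpace X] [T2Space X] {p : CStarSeminorm A}
    {f g : Compl p → X} (hf : Continuous f) (hg : Continuous g)
    (h : ∀ a, f (coeHom p a) = g (coeHom p a)) : f = g :=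
  Completion.ext hf hg h

/-- The connecting morphism `A_q → A_p` for `p ≤ q`. -/
def transition {p q : CStarSeminorm A} (h : p ≤ q) : Compl q →⋆ₙₐ[ℂ] Compl p :=
  map (NonUnitalStarAlgHom.id ℂ A) h

end Compl

/-- The reflection of `A` in the category of pro-`C*`-algebras: the limit of the `C*`-algebras
`A_p` over the directed set of continuous `C*`-seminorms `p`, realized as the `*`-algebra of
compatible families in the product, with the topology induced by the product topology. -/
def proCStar (A : Type u) [NonUnitalRing A] [StarRing A] [Module ℂ A] [TopologicalSpace A] :
    NonUnitalStarSubalgebra ℂ (∀ p : CStarSeminorm A, Compl p) where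
  carrier := {x | ∀ (p q : CStarSeminorm A) (h : p ≤ q), Compl.transition h (x q) = x p}
  add_mem' hx hy p q h := by simp [hx p q h, hy p q h]
  zero_mem' p q h := by simp
  mul_mem' hx hy p q h := by simp [hx p q h, hy p q h]
  smul_mem' c x hx p q h := by simp [hx p q h]
  star_mem' hx p q h := by simp [hx p q h, map_star]

/-- The reflection morphism `η_A : A → lim A_p`, `a ↦ (a + ker p)_p`. -/
def eta (A : Type u) [NonUnitalRing A] [StarRing A] [Module ℂ A] [TopologicalSpace A] :
    A →⋆ₙₐ[ℂ] proCStar A where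
  toFun a := ⟨fun p => Compl.coeHom p a, fun _ _ h =>
    Compl.map_coeHom (NonUnitalStarAlgHom.id ℂ A) h a⟩
  map_smul' c a := Subtype.ext (funext fun p => map_smul (Compl.coeHom p) c a)
  map_zero' := Subtype.ext (funext fun p => map_zero (Compl.coeHom p))
  map_add' a b := Subtype.ext (funext fun p => map_add (Compl.coeHom p) a b)
  map_mul' a b := Subtype.ext (funext fun p => map_mul (Compl.coeHom p) a b)
  map_star' a := Subtype.ext (funext fun p => map_star (Compl.coeHom p) a)

theorem continuous_eta [IsTopologicalRing A] : Continuous (eta A) :=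
  (continuous_pi fun p => Compl.continuous_coeHom p).subtype_mk _

/-- The morphism `φ_r : A_{r ∘ φ} → B_r` induced by a morphism `φ : A → B`. -/
def Compl.pullMap (φ : A →⋆ₙₐ[ℂ] B) (hφ : Continuous φ) (r : CStarSeminorm B) :
    Compl (r.comap φ hφ) →⋆ₙₐ[ℂ] Compl r :=
  Compl.map φ fun a => le_refl (r (φ a))

theorem Compl.transition_pullMap (φ : A →⋆ₙₐ[ℂ] B) (hφ : Continuous φ) {r s : CStarSeminorm B}
    (h : r ≤ s) (h' : r.comap φ hφ ≤ s.comap φ hφ) (y : Compl (s.comap φ hφ)) :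
    Compl.transition h (Compl.pullMap φ hφ s y) =
      Compl.pullMap φ hφ r (Compl.transition h' y) := by
  refine congrFun (Compl.ext_coeHom (f := fun y => Compl.transition h (Compl.pullMap φ hφ s y))
      (g := fun y => Compl.pullMap φ hφ r (Compl.transition h' y))
      ((Compl.continuous_map _ _).comp (Compl.continuous_map _ _))
      ((Compl.continuous_map _ _).comp (Compl.continuous_map _ _)) fun a => ?_) y
  calc
    _ = Compl.transition h (Compl.coeHom s (φ a)) := congrArg _ (Compl.map_coeHom φ _ a)
    _ = Compl.coeHom r (φ a) := Compl.map_coeHom (NonUnitalStarAlgHom.id ℂ B) h (φ a)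
    _ = Compl.pullMap φ hφ r (Compl.coeHom (r.comap φ hφ) a) := (Compl.map_coeHom φ _ a).symm
    _ = _ := congrArg _ (Compl.map_coeHom (NonUnitalStarAlgHom.id ℂ A) h' a).symm

/-- The action of the pro-`C*` reflector on a morphism `φ : A → B`: the map
`(x_p)_p ↦ (φ_r (x_{r ∘ φ}))_r`. -/
def proMap (φ : A →⋆ₙₐ[ℂ] B) (hφ : Continuous φ) : proCStar A →⋆ₙₐ[ℂ] proCStar B where
  toFun x := ⟨fun r => Compl.pullMap φ hφ r (x.1 (r.comap φ hφ)), fun r s h => by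
    have h' : r.comap φ hφ ≤ s.comap φ hφ := fun a => h (φ a)
    exact (Compl.transition_pullMap φ hφ h h' _).trans (congrArg _ (x.2 _ _ h'))⟩
  map_smul' c x := Subtype.ext (funext fun r => map_smul (Compl.pullMap φ hφ r) c _)
  map_zero' := Subtype.ext (funext fun r => map_zero (Compl.pullMap φ hφ r))
  map_add' x y := Subtype.ext (funext fun r => map_add (Compl.pullMap φ hφ r) _ _)
  map_mul' x y := Subtype.ext (funext fun r => map_mul (Compl.pullMap φ hφ r) _ _)
  map_star' x := Subtype.ext (funext fun r => map_star (Compl.pullMap φ hφ r) _)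

theorem continuous_proMap (φ : A →⋆ₙₐ[ℂ] B) (hφ : Continuous φ) : Continuous (proMap φ hφ) := by
  refine continuous_induced_rng.2 (continuous_pi fun r => ?_)
  have h1 : Continuous fun x : proCStar A => x.1 (r.comap φ hφ) :=
    (continuous_apply (r.comap φ hφ)).comp continuous_subtype_val
  have h2 : Continuous (Compl.pullMap φ hφ r) := Compl.continuous_map φ _
  exact h2.comp h1

theorem proMap_eta (φ : A →⋆ₙₐ[ℂ] B) (hφ : Continuous φ) (a : A) :
    proMap φ hφ (eta A a) = eta B (φ a) :=
  Subtype.ext (funext fun _ => Compl.map_coeHom φ _ a)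

/-- `PC*(A)`: the image `η_A(A)` with the subspace topology of the pro-`C*` reflection. -/
def pcStar (A : Type u) [NonUnitalRing A] [StarRing A] [Module ℂ A] [TopologicalSpace A] :
    NonUnitalStarSubalgebra ℂ (proCStar A) :=
  NonUnitalStarAlgHom.range (eta A)

/-- The reflection morphism `α_A : A → PC*(A)`, which is `η_A` with restricted codomain. -/
def alpha (A : Type u) [NonUnitalRing A] [StarRing A] [Module ℂ A] [TopologicalSpace A] :
    A →⋆ₙₐ[ℂ] pcStar A :=
  NonUnitalStarAlgHom.codRestrict (eta A) (pcStar A) fun a => ⟨a, rfl⟩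

/-- The action of the reflector `PC*` on morphisms. -/
def pcMap (φ : A →⋆ₙₐ[ℂ] B) (hφ : Continuous φ) : pcStar A →⋆ₙₐ[ℂ] pcStar B :=
  NonUnitalStarAlgHom.codRestrict
    ((proMap φ hφ).comp (NonUnitalStarSubalgebraClass.subtype (pcStar A))) (pcStar B) (by
      rintro ⟨_, a, rfl⟩
      exact ⟨φ a, (proMap_eta φ hφ a).symm⟩)

end Seminorms

section Lifts

/-- The Kuratowski closure `K`: the topological closure of a `*`-subalgebra. -/
def kuratowski {A : Type u} [NonUnitalRing A] [StarRing A] [Module ℂ A] [TopologicalSpace A]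
    [IsTopologicalRing A] [ContinuousStar A] [ContinuousConstSMul ℂ A]
    (S : NonUnitalStarSubalgebra ℂ A) : NonUnitalStarSubalgebra ℂ A :=
  S.topologicalClosure

variable {A : Type u} [NonUnitalRing A] [StarRing A] [Module ℂ A] [IsScalarTower ℂ A A]
  [SMulCommClass ℂ A A] [StarModule ℂ A] [TopologicalSpace A]

/-- The `PC*`-initial lift `K^α` of the Kuratowski closure along `α`:
`K^α(m) = α⁻¹(K(PC*(m)))`, where the closure of the morphism `PC*(m)` is the closure of its image
(with respect to the (surjective, embedding) factorization) in `PC*(A)`. -/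
def liftAlpha (S : NonUnitalStarSubalgebra ℂ A) : NonUnitalStarSubalgebra ℂ A :=
  (kuratowski (NonUnitalStarAlgHom.range
    (pcMap (NonUnitalStarSubalgebraClass.subtype S) continuous_subtype_val))).comap (alpha A)

/-- The pro-`C*`-initial lift `K^η` of the Kuratowski closure along `η`: `K^η(m) = η⁻¹(K(Fm))`,
where `F` is the pro-`C*` reflector and the closure of the morphism `Fm` is that of its image with
respect to the (dense image, closed embedding) factorization, i.e. of the closure of its range. -/
def liftEta (S : NonUnitalStarSubalgebra ℂ A) : NonUnitalStarSubalgebra ℂ A :=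
  (kuratowski (NonUnitalStarAlgHom.range
    (proMap (NonUnitalStarSubalgebraClass.subtype S)
      continuous_subtype_val)).topologicalClosure).comap (eta A)

end Lifts

section Notions

/-- The product of a family of `*`-subalgebras, as a `*`-subalgebra of the product. -/
def piSubalgebra {ι : Type} {A : ι → Type u} [∀ i, NonUnitalRing (A i)] [∀ i, StarRing (A i)]
    [∀ i, Module ℂ (A i)] (S : ∀ i, NonUnitalStarSubalgebra ℂ (A i)) :
    NonUnitalStarSubalgebra ℂ (∀ i, A i) where
  carrier := {x | ∀ i, x i ∈ S i}
  add_mem' hx hy i := add_mem (hx i) (hy i)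
  zero_mem' i := zero_mem (S i)
  mul_mem' hx hy i := mul_mem (hx i) (hy i)
  smul_mem' c _ hx i := SMulMemClass.smul_mem c (hx i)
  star_mem' hx i := star_mem (hx i)

/-- The diagonal of `A × A`. -/
def diagonal (A : Type u) [NonUnitalRing A] [StarRing A] [Module ℂ A] :
    NonUnitalStarSubalgebra ℂ (A × A) where
  carrier := {x | x.1 = x.2}
  add_mem' hx hy := congrArg₂ (· + ·) hx hy
  zero_mem' := rfl
  mul_mem' hx hy := congrArg₂ (· * ·) hx hy
  smul_mem' c _ hx := congrArg (c • ·) hx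
  star_mem' hx := congrArg star hx

/-- `A` is `c^*`-separated: the diagonal of `A × A` is `c^*`-closed. -/
def IsCStarSeparated (A : Type u) [NonUnitalRing A] [StarRing A] [Module ℂ A]
    [TopologicalSpace A] : Prop :=
  cStar (diagonal A) = diagonal A

/-- `A` is `c^*`-compact: for every topological `*`-algebra `B`, the projection `A × B → B`
preserves the closure operator `c^*`. -/
def IsCStarCompact (A : Type u) [NonUnitalRing A] [StarRing A] [Module ℂ A]
    [TopologicalSpace A] : Prop :=
  ∀ (B : Type u) [NonUnitalRing B] [StarRing B] [Module ℂ B] [IsScalarTower ℂ B B]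
    [SMulCommClass ℂ B B] [StarModule ℂ B] [TopologicalSpace B] [IsTopologicalRing B]
    [ContinuousStar B] (S : NonUnitalStarSubalgebra ℂ (A × B)),
    (cStar S).map (NonUnitalStarAlgHom.snd ℂ A B) =
      cStar (S.map (NonUnitalStarAlgHom.snd ℂ A B))

/-- `A` is `K`-compact in `P*A`: it is an object of `P*A` and for every object `B` of `P*A`, the
projection `A × B → B` preserves the Kuratowski closure of `*`-subalgebras. -/
def IsKCompactInPStar (A : Type u) [NonUnitalRing A] [StarRing A] [Module ℂ A]
    [TopologicalSpace A] : Prop :=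
  IsPStar A ∧
    ∀ (B : Type u) [NonUnitalRing B] [StarRing B] [Module ℂ B] [IsScalarTower ℂ B B]
      [SMulCommClass ℂ B B] [StarModule ℂ B] [TopologicalSpace B] [IsTopologicalRing B]
      [ContinuousStar B], IsPStar B → ∀ S : NonUnitalStarSubalgebra ℂ (A × B),
      Prod.snd '' closure (S : Set (A × B)) = closure (Prod.snd '' (S : Set (A × B)))

end Notions

end

end TopStarAlg

/-! Everything rests on one identification: the `*`-representation topology is the topology induced
by `η_A` (`repTopology_eq_induced_eta`). A representation `π` is contractive for its own
`C*`-seminorm `‖π ·‖`, so it factors continuously through a coordinate of the limit. Conversely, by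
Gelfand–Naimark each `A_p` embeds isometrically in some `B(H)`, so every coordinate of `η_A` is
continuous for the representation topology. Hence `c^*(S)` is the preimage under `η_A`, or under
`α_A`, of the ordinary closure of the image of `S` (`coe_cStar_eq_preimage`).

For (a) it remains to compare images: that of `PC^*(m)` is exactly `α_A(S)`, and `η_A(S)` is dense
in that of the pro-`C*` reflection of `m`, because `η_S` has dense range.

For (b)–(d) the identification is extended to finite products: a representation of a product is a
sum of maps, each depending on one factor through its `η`. This gives productivity, and shows that
the `c^*`-closure of the diagonal is the kernel pair of `η_A`. It also makes `α_A × α_B` induce the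
representation topology on `A × B`, so closures can be moved between `A × B` and `PC^*(A) ×
PC^*(B)`. Surjectivity of `η_A` follows by projecting the closed graph of the inclusion of `PC^*(A)`
into the limit. -/

namespace TopStarAlg

open UniformSpace Topology

noncomputable section

/-! ### The Gelfand–Naimark theorem for non-unital `C*`-algebras. -/

section GelfandNaimark

open scoped ComplexOrder ComplexStarModule

/-- In a `C*`-algebra, every nonzero element of the form `c* c` is detected by a positive
functional. -/
theorem exists_positive_functional_pos {A : Type*} [NonUnitalCStarAlgebra A] [PartialOrder A]
    [StarOrderedRing A] {c : A} (hc : c ≠ 0) : ∃ f : A →ₚ[ℂ] ℂ, f (star c * c) ≠ 0 := by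
  have hpos : 0 ≤ star c * c := star_mul_self_nonneg c
  -- The positive cone is closed, convex and meets its negative only in `0`, so Hahn–Banach
  -- separates it from `-(c* c)`.
  have hmem : -(star c * c) ∉ ProperCone.positive ℝ A := by
    rw [ProperCone.mem_positive]
    intro h
    exact hc (CStarRing.star_mul_self_eq_zero_iff c |>.1
      (le_antisymm (neg_nonneg.1 h) hpos))
  obtain ⟨g, hg, hg'⟩ := ProperCone.hyperplane_separation_point _ hmem
  -- Precomposing with the real part makes the complexification agree with `g` on self-adjoint
  -- elements, since `i x` then has real part `0`.
  let F : Module.Dual ℝ A :=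
    g.toLinearMap ∘ₗ (selfAdjoint.submodule ℝ A).subtype ∘ₗ realPart
  have hF (x : A) (hx : IsSelfAdjoint x) : (F.extendRCLike : Module.Dual ℂ A) x = g x := by
    rw [Module.Dual.extendRCLike_apply]
    have h1 : F x = g x := by
      simp only [F, LinearMap.comp_apply]
      exact congrArg g hx.coe_realPart
    have h2 : F (Complex.I • x) = 0 := by
      change g ((ℜ (Complex.I • x) : selfAdjoint A) : A) = 0
      rw [realPart_I_smul, hx.imaginaryPart]
      simp
    simp [h1, h2]
  refine ⟨PositiveLinearMap.mk₀ F.extendRCLike fun x hx => ?_, ?_⟩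
  · rw [hF x (IsSelfAdjoint.of_nonneg hx)]
    exact_mod_cast hg x hx
  · change (F.extendRCLike : Module.Dual ℂ A) (star c * c) ≠ 0
    rw [hF _ (IsSelfAdjoint.star_mul_self c)]
    rw [map_neg, neg_lt_zero] at hg'
    exact_mod_cast hg'.ne'

/-- Every nonzero element of a `C*`-algebra is detected by a GNS representation. -/
theorem exists_gns_ne_zero {A : Type*} [NonUnitalCStarAlgebra A] [PartialOrder A]
    [StarOrderedRing A] {a : A} (ha : a ≠ 0) :
    ∃ f : A →ₚ[ℂ] ℂ, f.gnsNonUnitalStarAlgHom a ≠ 0 := by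
  -- Without a unit there is no canonical cyclic vector. The class of `a*` serves instead: it is
  -- sent by `a` to the class of `a a*`, whose squared norm is `f ((a a*)* (a a*))`.
  have hc : a * star a ≠ 0 := (CStarRing.mul_star_self_ne_zero_iff a).2 ha
  obtain ⟨f, hf⟩ := exists_positive_functional_pos hc
  refine ⟨f, fun h => hf ?_⟩
  have h0 : ((f.leftMulMapPreGNS a (f.toPreGNS (star a)) : f.PreGNS) : f.GNS) = 0 := by
    rw [← PositiveLinearMap.gnsNonUnitalStarAlgHom_apply_coe, h]
    rfl
  have h1 : ‖f.toPreGNS (a * star a)‖ = 0 := by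
    rw [← Completion.norm_coe]
    exact norm_eq_zero.2 h0
  have h2 := f.preGNS_norm_sq (f.toPreGNS (a * star a))
  rw [h1] at h2
  simpa using h2.symm

/-- The direct sum of a family of representations of a `C*`-algebra. -/
def directSumRep {A : Type*} [NonUnitalCStarAlgebra A] {ι : Type*} {H : ι → Type*}
    [∀ i, NormedAddCommGroup (H i)] [∀ i, InnerProductSpace ℂ (H i)] [∀ i, CompleteSpace (H i)]
    (π : ∀ i, A →⋆ₙₐ[ℂ] (H i →L[ℂ] H i)) : A →⋆ₙₐ[ℂ] (lp H 2 →L[ℂ] lp H 2) where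
  toFun a := lp.mapCLM 2 (fun i => π i a) (norm_nonneg a)
    fun i => NonUnitalStarAlgHom.norm_apply_le (π i) a
  map_smul' c a := by ext x i; simp
  map_zero' := by ext x i; simp
  map_add' a b := by ext x i; simp
  map_mul' a b := by ext x i; simp
  map_star' a := by
    rw [ContinuousLinearMap.star_eq_adjoint, ContinuousLinearMap.eq_adjoint_iff]
    intro x y
    simp only [lp.inner_eq_tsum]
    refine tsum_congr fun i => ?_
    simp [map_star, ContinuousLinearMap.star_eq_adjoint, ContinuousLinearMap.adjoint_inner_left]

theorem directSumRep_apply {A : Type*} [NonUnitalCStarAlgebra A] {ι : Type*} {H : ι → Type*}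
    [∀ i, NormedAddCommGroup (H i)] [∀ i, InnerProductSpace ℂ (H i)] [∀ i, CompleteSpace (H i)]
    (π : ∀ i, A →⋆ₙₐ[ℂ] (H i →L[ℂ] H i)) (a : A) (x : lp H 2) (i : ι) :
    directSumRep π a x i = π i a (x i) := rfl

/-- The Gelfand–Naimark theorem: every `C*`-algebra has an isometric representation. -/
theorem exists_isometric_rep (A : Type u) [NonUnitalCStarAlgebra A] :
    ∃ π : Representation A, Isometry π.hom := by
  classical
  let _ := CStarAlgebra.spectralOrder A
  have _ := CStarAlgebra.spectralOrderedRing A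
  -- One GNS representation for each nonzero element; the index type lies in the universe of `A`,
  -- hence so does the direct sum.
  choose f hf using fun a : {a : A // a ≠ 0} => exists_gns_ne_zero a.2
  let π := directSumRep fun a => (f a).gnsNonUnitalStarAlgHom
  have hinj : Function.Injective π := by
    rw [injective_iff_map_eq_zero]
    intro a ha
    by_contra hne
    refine hf ⟨a, hne⟩ (ContinuousLinearMap.ext fun v => ?_)
    -- Evaluating on a vector supported in the summand of `a` recovers the GNS operator of `a`.
    have h := congrArg (fun T => (T (lp.single 2 ⟨a, hne⟩ v) : lp _ 2) ⟨a, hne⟩) ha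
    simpa [π, directSumRep_apply] using h
  have hiso := NonUnitalStarAlgHom.isometry π hinj
  exact ⟨⟨_, π, hiso.continuous⟩, hiso⟩

end GelfandNaimark

/-! ### The representation topology and closures in it. -/

section RepTopology

variable {A : Type u} [NonUnitalRing A] [StarRing A] [Module ℂ A] [TopologicalSpace A]

/-- The continuous `C*`-seminorm `a ↦ ‖π a‖` of a representation `π`. -/
def Representation.seminorm (π : Representation A) : CStarSeminorm A where
  toFun a := ‖π.hom a‖
  map_zero' := by simp
  add_le' a b := by rw [map_add]; exact norm_add_le _ _
  neg' a := by
    have : π.hom (-a) = -π.hom a := map_neg π.hom a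
    rw [this, norm_neg]
  smul' c a := by rw [map_smul, norm_smul]
  mul_le' a b := by
    rw [map_mul]; exact norm_mul_le _ _
  star_mul_self' a := by
    rw [map_mul, map_star, CStarRing.norm_star_mul_self, sq]
  continuous' := π.continuous_hom.norm

/-- Every representation factors continuously through `η_A`. -/
theorem Representation.exists_factor_eta (π : Representation A) :
    ∃ u : proCStar A → (π.H →L[ℂ] π.H), Continuous u ∧ ∀ a, u (eta A a) = π.hom a := by
  -- For the seminorm `‖π ·‖`, `π` is Lipschitz with constant `1` and extends to the completion.
  -- Only continuity of the extension is needed, so multiplicativity is not tracked.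
  let f : WithSeminorm π.seminorm →⋆ₙₐ[ℂ] (π.H →L[ℂ] π.H) :=
    π.hom.comp (WithSeminorm.out π.seminorm)
  have hf : UniformContinuous f :=
    (AddMonoidHomClass.lipschitz_of_bound f 1 fun a => by rw [one_mul]; rfl).uniformContinuous
  refine ⟨fun x => Completion.extension f (x.1 π.seminorm),
    Completion.continuous_extension.comp
      ((continuous_apply π.seminorm).comp continuous_subtype_val), fun a => ?_⟩
  exact Completion.extension_coe hf _

/-- A continuous `*`-homomorphism into a `C*`-algebra is continuous for the `*`-representation
topology. -/
theorem continuous_repTopology {B : Type u} [NonUnitalCStarAlgebra B] (f : A →⋆ₙₐ[ℂ] B)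
    (hf : Continuous f) : @Continuous A B (repTopology A) _ f := by
  obtain ⟨ρ, hρ⟩ := exists_isometric_rep B
  -- Composed with an isometric representation `ρ`, the map `f` becomes one of the representations
  -- defining the topology.
  have h := continuous_initialTopology (fun π : Representation A => π.hom)
    ⟨ρ.H, ρ.hom.comp f, hρ.continuous.comp hf⟩
  let _ := repTopology A
  exact hρ.isUniformInducing.isInducing.continuous_iff.2 h

theorem le_repTopology : (inferInstance : TopologicalSpace A) ≤ repTopology A :=
  le_iInf fun π => π.continuous_hom.le_induced

/-- Closure in an induced topology is the preimage of the closure of the image. The inducing map is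
left free so that `η`, `α` or a product of such maps can be used as convenient. -/
theorem coe_cStar_eq_preimage {Y : Type*} [tY : TopologicalSpace Y] {g : A → Y}
    (h : repTopology A = tY.induced g) (S : NonUnitalStarSubalgebra ℂ A) :
    (cStar S : Set A) = g ⁻¹' closure (g '' (S : Set A)) := by
  rw [coe_cStar, h]
  ext a
  exact closure_induced

theorem coe_zeroSubalgebra (A : Type u) [NonUnitalRing A] [StarRing A] [Module ℂ A] :
    (zeroSubalgebra A : Set A) = {0} := rfl

/-- A Hausdorff algebra whose topology is induced by morphisms into `C*`-algebras is an object of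
`P*A`. -/
theorem isPStar_of_isInducing [T2Space A] {ι : Type*} {B : ι → Type u}
    [∀ i, NonUnitalCStarAlgebra (B i)] (f : ∀ i, A →⋆ₙₐ[ℂ] B i)
    (hf : IsInducing fun a i => f i a) : IsPStar A := by
  have h : (inferInstance : TopologicalSpace A) = repTopology A := by
    -- The other inequality holds because each `f i` stays continuous for the representation
    -- topology, by Gelfand–Naimark.
    refine le_antisymm le_repTopology ?_
    rw [show (inferInstance : TopologicalSpace A) = _ from hf.eq_induced]
    refine Continuous.le_induced (@continuous_pi _ _ _ (repTopology A) _ _ fun i => ?_)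
    exact continuous_repTopology (f i) ((continuous_apply i).comp hf.continuous)
  refine ⟨h, SetLike.coe_injective ?_⟩
  rw [reducingIdeal, coe_cStar, ← h, coe_zeroSubalgebra]
  exact closure_singleton

theorem IsPStar.coe_cStar {A : Type u} [NonUnitalRing A] [StarRing A] [Module ℂ A]
    [TopologicalSpace A] (hA : IsPStar A) (S : NonUnitalStarSubalgebra ℂ A) :
    (cStar S : Set A) = closure (S : Set A) := by
  rw [TopStarAlg.coe_cStar, ← hA.1]

end RepTopology

/-! ### The representation topology is induced by `η`, also on finite products. -/

section Eta

variable (A : Type u) [NonUnitalRing A] [StarRing A] [Module ℂ A] [IsScalarTower ℂ A A]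
  [SMulCommClass ℂ A A] [StarModule ℂ A] [TopologicalSpace A] [IsTopologicalRing A]

/-- The `*`-representation topology is the topology induced by `η_A`. -/
theorem repTopology_eq_induced_eta :
    repTopology A = TopologicalSpace.induced (eta A) inferInstance := by
  apply le_antisymm
  · refine Continuous.le_induced (continuous_induced_rng.2
      (@continuous_pi _ _ _ (repTopology A) _ _ fun p => ?_))
    exact continuous_repTopology (Compl.coeHom p) (Compl.continuous_coeHom p)
  · refine le_iInf fun π => ?_
    obtain ⟨u, hu, h⟩ := π.exists_factor_eta
    rw [show (π.hom : A → _) = u ∘ eta A from funext fun a => (h a).symm, ← induced_compose]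
    exact induced_mono hu.le_induced

theorem repTopology_eq_induced_alpha :
    repTopology A = TopologicalSpace.induced (alpha A) inferInstance := by
  rw [repTopology_eq_induced_eta]
  exact (induced_compose (f := alpha A) (g := Subtype.val)).symm

variable {A}

/-- A continuous morphism followed by `η` is continuous for the `*`-representation topology. -/
theorem continuous_eta_comp_repTopology {B : Type u} [NonUnitalRing B] [StarRing B] [Module ℂ B]
    [TopologicalSpace B] (φ : B →⋆ₙₐ[ℂ] A) (hφ : Continuous φ) :
    @Continuous B (proCStar A) (repTopology B) _ fun b => eta A (φ b) := by
  refine continuous_induced_rng.2 (@continuous_pi _ _ _ (repTopology B) _ _ fun p => ?_)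
  exact continuous_repTopology ((Compl.coeHom p).comp φ) ((Compl.continuous_coeHom p).comp hφ)

/-- The `*`-representation topology of a binary product. -/
theorem repTopology_prod (A B : Type u)
    [NonUnitalRing A] [StarRing A] [Module ℂ A] [IsScalarTower ℂ A A]
    [SMulCommClass ℂ A A] [StarModule ℂ A] [TopologicalSpace A] [IsTopologicalRing A]
    [NonUnitalRing B] [StarRing B] [Module ℂ B] [IsScalarTower ℂ B B]
    [SMulCommClass ℂ B B] [StarModule ℂ B] [TopologicalSpace B] [IsTopologicalRing B] :
    repTopology (A × B) =
      TopologicalSpace.induced (Prod.map (eta A) (eta B)) inferInstance := by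
  apply le_antisymm
  · refine Continuous.le_induced (@Continuous.prodMk _ _ _ _ _ (repTopology (A × B)) _ _ ?_ ?_)
    · exact continuous_eta_comp_repTopology (NonUnitalStarAlgHom.fst ℂ A B) continuous_fst
    · exact continuous_eta_comp_repTopology (NonUnitalStarAlgHom.snd ℂ A B) continuous_snd
  · refine le_iInf fun π => ?_
    obtain ⟨u, hu, h⟩ := Representation.exists_factor_eta (A := A)
      ⟨π.H, π.hom.comp (NonUnitalStarAlgHom.inl ℂ A B),
        π.continuous_hom.comp (Continuous.prodMk_left 0)⟩
    obtain ⟨v, hv, h'⟩ := Representation.exists_factor_eta (A := B)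
      ⟨π.H, π.hom.comp (NonUnitalStarAlgHom.inr ℂ A B),
        π.continuous_hom.comp (Continuous.prodMk_right 0)⟩
    -- Since `(a, b) = (a, 0) + (0, b)`, `π` is the sum of its restrictions to the two factors, each
    -- of which factors through `η`.
    have key : (π.hom : A × B → _) =
        (fun y => u y.1 + v y.2) ∘ Prod.map (eta A) (eta B) := by
      funext x
      refine Eq.trans ?_ (congrArg₂ (· + ·) (h x.1) (h' x.2)).symm
      change π.hom x = π.hom (x.1, 0) + π.hom (0, x.2)
      rw [← map_add]
      simp
    rw [key, ← induced_compose]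
    exact induced_mono
      ((hu.comp continuous_fst).add (hv.comp continuous_snd)).le_induced

/-- The representation topology of a product is the product of the representation topologies, so
each `η` may be replaced by any map inducing the same topology: `α`, or the identity on an object of
`P*A`. -/
theorem repTopology_prod_eq_induced {A B : Type u}
    [NonUnitalRing A] [StarRing A] [Module ℂ A] [IsScalarTower ℂ A A]
    [SMulCommClass ℂ A A] [StarModule ℂ A] [TopologicalSpace A] [IsTopologicalRing A]
    [NonUnitalRing B] [StarRing B] [Module ℂ B] [IsScalarTower ℂ B B]
    [SMulCommClass ℂ B B] [StarModule ℂ B] [TopologicalSpace B] [IsTopologicalRing B]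
    {X Y : Type*} [tX : TopologicalSpace X] [tY : TopologicalSpace Y] {f : A → X} {g : B → Y}
    (hf : repTopology A = tX.induced f) (hg : repTopology B = tY.induced g) :
    repTopology (A × B) = TopologicalSpace.induced (Prod.map f g) inferInstance := by
  refine (repTopology_prod A B).trans ((prod_induced_induced (eta A) (eta B)).symm.trans ?_)
  refine Eq.trans ?_ (prod_induced_induced f g)
  exact congrArg₂ (@instTopologicalSpaceProd A B)
    ((repTopology_eq_induced_eta A).symm.trans hf) ((repTopology_eq_induced_eta B).symm.trans hg)

/-- The inclusion of a factor of a product of `*`-algebras. -/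
def piSingle {ι : Type*} [DecidableEq ι] {A : ι → Type*} [∀ i, NonUnitalRing (A i)]
    [∀ i, StarRing (A i)] [∀ i, Module ℂ (A i)] (i : ι) : A i →⋆ₙₐ[ℂ] (∀ i, A i) where
  toFun := Pi.single i
  map_smul' c a := Pi.single_smul i c a
  map_zero' := Pi.single_zero i
  map_add' a b := Pi.single_add i a b
  map_mul' a b := Pi.single_mul i a b
  map_star' a := (Pi.single_star i a)

/-- The `*`-representation topology of a finite product. -/
theorem repTopology_pi {ι : Type} [Finite ι] (A : ι → Type u)
    [∀ i, NonUnitalRing (A i)] [∀ i, StarRing (A i)]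
    [∀ i, Module ℂ (A i)] [∀ i, IsScalarTower ℂ (A i) (A i)] [∀ i, SMulCommClass ℂ (A i) (A i)]
    [∀ i, StarModule ℂ (A i)] [∀ i, TopologicalSpace (A i)] [∀ i, IsTopologicalRing (A i)] :
    repTopology (∀ i, A i) =
      TopologicalSpace.induced (fun x i => eta (A i) (x i)) inferInstance := by
  classical
  have := Fintype.ofFinite ι
  apply le_antisymm
  · refine Continuous.le_induced (@continuous_pi _ _ _ (repTopology (∀ i, A i)) _ _ fun i => ?_)
    exact continuous_eta_comp_repTopology (Pi.evalNonUnitalStarAlgHom ℂ A i) (continuous_apply i)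
  · refine le_iInf fun π => ?_
    choose u hu h using fun i => Representation.exists_factor_eta (A := A i)
      ⟨π.H, π.hom.comp (piSingle i), π.continuous_hom.comp (continuous_single i)⟩
    -- Finiteness enters here: an element is the sum of its coordinates.
    have key : (π.hom : (∀ i, A i) → _) =
        (fun y => ∑ i, u i (y i)) ∘ fun x i => eta (A i) (x i) := by
      funext x
      refine Eq.trans ?_ (Finset.sum_congr rfl fun i _ => (h i (x i)).symm)
      change π.hom x = ∑ i, π.hom (Pi.single i (x i))
      rw [← map_sum, Finset.univ_sum_single]
    rw [key, ← induced_compose]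
    exact induced_mono
      (continuous_finsetSum _ fun i _ => (hu i).comp (continuous_apply i)).le_induced

end Eta

/-! ### Directedness of the `C*`-seminorms and density of `η_A(A)`. -/

section Density

variable {A : Type u} [NonUnitalRing A] [StarRing A] [Module ℂ A] [TopologicalSpace A]

/-- The pointwise maximum of two continuous `C*`-seminorms. -/
def CStarSeminorm.max (p q : CStarSeminorm A) : CStarSeminorm A where
  toSeminorm := p.toSeminorm ⊔ q.toSeminorm
  mul_le' a b := by
    have hp := p.mul_le' a b
    have hq := q.mul_le' a b
    have hmul {x y x' y' z : ℝ} (hz : z ≤ x * y) (hx : x ≤ x') (hy : y ≤ y') (h0 : 0 ≤ y)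
        (h0' : 0 ≤ x') : z ≤ x' * y' := hz.trans (mul_le_mul hx hy h0 h0')
    exact max_le
      (hmul hp (le_max_left _ _) (le_max_left _ _) (p.nonneg b)
        ((p.nonneg a).trans (le_max_left _ _)))
      (hmul hq (le_max_right _ _) (le_max_right _ _) (q.nonneg b)
        ((p.nonneg a).trans (le_max_left _ _)))
  star_mul_self' a := by
    change Max.max (p (star a * a)) (q (star a * a)) = Max.max (p a) (q a) ^ 2
    rw [p.star_mul_self', q.star_mul_self']
    rcases le_total (p a) (q a) with h | h
    · rw [max_eq_right h, max_eq_right (pow_le_pow_left₀ (p.nonneg a) h 2)]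
    · rw [max_eq_left h, max_eq_left (pow_le_pow_left₀ (q.nonneg a) h 2)]
  continuous' := p.continuous'.max q.continuous'

/-- The zero seminorm. -/
def CStarSeminorm.zero (A : Type u) [NonUnitalRing A] [StarRing A] [Module ℂ A]
    [TopologicalSpace A] : CStarSeminorm A where
  toSeminorm := 0
  mul_le' _ _ := (mul_zero (0 : ℝ)).ge
  star_mul_self' _ := (zero_pow two_ne_zero).symm
  continuous' := continuous_const

/-- The continuous `C*`-seminorms are directed. -/
theorem CStarSeminorm.exists_finset_le (I : Finset (CStarSeminorm A)) :
    ∃ q : CStarSeminorm A, ∀ p ∈ I, p ≤ q := by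
  classical
  induction I using Finset.induction_on with
  | empty => exact ⟨CStarSeminorm.zero A, by simp⟩
  | insert p I _ ih =>
    obtain ⟨q, hq⟩ := ih
    refine ⟨p.max q, fun r hr a => ?_⟩
    rcases Finset.mem_insert.1 hr with rfl | hr
    · exact le_max_left _ _
    · exact (hq r hr a).trans (le_max_right _ _)

theorem Compl.denseRange_coeHom (p : CStarSeminorm A) : DenseRange (Compl.coeHom p) :=
  Completion.denseRange_coe (α := WithSeminorm p)

/-- A basic neighbourhood of `x` constrains finitely many coordinates. All of them are continuous
images of the coordinate at one dominating `q`, and `A` is dense in `A_q`. -/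
theorem denseRange_eta : DenseRange (eta A) := by
  intro x
  rw [mem_closure_iff]
  rintro _ ⟨V, hV, rfl⟩ hx
  obtain ⟨I, U, hU, hIV⟩ := isOpen_pi_iff.1 hV x.1 hx
  obtain ⟨q, hq⟩ := CStarSeminorm.exists_finset_le I
  have hopen : IsOpen {y : Compl q | ∀ p : I, Compl.transition (hq p p.2) y ∈ U p} := by
    rw [Set.ofPred_forall]
    exact isOpen_iInter_of_finite fun p =>
      (hU p p.2).1.preimage (Compl.continuous_map _ _)
  obtain ⟨a, ha⟩ := (Compl.denseRange_coeHom q).exists_mem_open hopen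
    ⟨x.1 q, fun p => by rw [x.2 p q (hq p p.2)]; exact (hU p p.2).2⟩
  refine ⟨eta A a, hIV fun p hp => ?_, a, rfl⟩
  rw [← (eta A a).2 p q (hq p hp)]
  exact ha ⟨p, hp⟩

end Density

/-! ### The initial lifts `K^α` and `K^η`. -/

section Lifts

variable {A : Type u} [NonUnitalRing A] [StarRing A] [Module ℂ A] [IsScalarTower ℂ A A]
  [SMulCommClass ℂ A A] [StarModule ℂ A] [TopologicalSpace A] [IsTopologicalRing A]

theorem alpha_surjective (A : Type u) [NonUnitalRing A] [StarRing A] [Module ℂ A]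
    [TopologicalSpace A] : Function.Surjective (alpha A) := by
  rintro ⟨_, a, rfl⟩
  exact ⟨a, rfl⟩

theorem pcMap_alpha {A B : Type u} [NonUnitalRing A] [StarRing A] [Module ℂ A]
    [TopologicalSpace A] [NonUnitalRing B] [StarRing B] [Module ℂ B] [TopologicalSpace B]
    (φ : A →⋆ₙₐ[ℂ] B) (hφ : Continuous φ) (a : A) :
    pcMap φ hφ (alpha A a) = alpha B (φ a) :=
  Subtype.ext (proMap_eta φ hφ a)

/-- Naturality of `α` together with its surjectivity: `PC^*` adds no limit points. -/
theorem range_pcMap {A B : Type u} [NonUnitalRing A] [StarRing A] [Module ℂ A]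
    [TopologicalSpace A] [NonUnitalRing B] [StarRing B] [Module ℂ B] [TopologicalSpace B]
    (φ : A →⋆ₙₐ[ℂ] B) (hφ : Continuous φ) :
    Set.range (pcMap φ hφ) = alpha B '' Set.range φ := by
  rw [← (alpha_surjective A).range_comp, ← Set.range_comp]
  exact congrArg Set.range (funext fun a => pcMap_alpha φ hφ a)

theorem coe_liftAlpha {A : Type u} [NonUnitalRing A] [StarRing A] [Module ℂ A]
    [TopologicalSpace A] (S : NonUnitalStarSubalgebra ℂ A) :
    (liftAlpha S : Set A) = alpha A ⁻¹' closure (alpha A '' (S : Set A)) := by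
  have hlift : (liftAlpha S : Set A) = alpha A ⁻¹' closure (Set.range
      (pcMap (NonUnitalStarSubalgebraClass.subtype S) continuous_subtype_val)) := rfl
  have h := congrArg (fun T : Set (pcStar A) => alpha A ⁻¹' closure T)
    (range_pcMap (NonUnitalStarSubalgebraClass.subtype S) continuous_subtype_val)
  have hS : Set.range (NonUnitalStarSubalgebraClass.subtype S) = (S : Set A) :=
    Subtype.range_coe
  exact (hlift.trans h).trans (congrArg (fun T => alpha A ⁻¹' closure (alpha A '' T)) hS)

theorem cStar_eq_liftAlpha (S : NonUnitalStarSubalgebra ℂ A) : cStar S = liftAlpha S :=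
  SetLike.coe_injective ((coe_cStar_eq_preimage (repTopology_eq_induced_alpha A) S).trans
    (coe_liftAlpha S).symm)

/-- The reflected inclusion may have a range larger than `η_A(S)`, but only by limit points: `η_S`
has dense range and the reflected map is continuous, so the two closures agree. -/
theorem cStar_eq_liftEta (S : NonUnitalStarSubalgebra ℂ A) : cStar S = liftEta S := by
  refine SetLike.coe_injective ((coe_cStar_eq_preimage (repTopology_eq_induced_eta A) S).trans ?_)
  change _ = eta A ⁻¹' closure (closure (Set.range
    (proMap (NonUnitalStarSubalgebraClass.subtype S) continuous_subtype_val)))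
  -- The factorization through a closed embedding has already taken one closure.
  rw [closure_closure]
  congr 1
  have h : eta A '' (S : Set A) =
      proMap (NonUnitalStarSubalgebraClass.subtype S) continuous_subtype_val ''
        Set.range (eta S) := by
    rw [← Set.range_comp, Set.image_eq_range]
    exact congrArg Set.range (funext fun s =>
      (proMap_eta (NonUnitalStarSubalgebraClass.subtype S) continuous_subtype_val s).symm)
  rw [h]
  refine subset_antisymm (closure_mono (Set.image_subset_range _ _))
    (closure_minimal ?_ isClosed_closure)
  rw [← Set.image_univ, ← (denseRange_eta (A := S)).closure_range]
  exact image_closure_subset_closure_image (continuous_proMap _ _)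

end Lifts

/-- The product of the maps `η` carries a product of subalgebras to the product of the images, and
closure commutes with products of sets. -/
theorem cStar_piSubalgebra {ι : Type} [Finite ι] {A : ι → Type u} [∀ i, NonUnitalRing (A i)]
    [∀ i, StarRing (A i)]
    [∀ i, Module ℂ (A i)] [∀ i, IsScalarTower ℂ (A i) (A i)] [∀ i, SMulCommClass ℂ (A i) (A i)]
    [∀ i, StarModule ℂ (A i)] [∀ i, TopologicalSpace (A i)] [∀ i, IsTopologicalRing (A i)]
    (S : ∀ i, NonUnitalStarSubalgebra ℂ (A i)) :
    cStar (piSubalgebra S) = piSubalgebra fun i => cStar (S i) := by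
  have himage : (fun x i => eta (A i) (x i)) '' (piSubalgebra S : Set (∀ i, A i)) =
      Set.univ.pi fun i => eta (A i) '' (S i : Set (A i)) := by
    ext y
    constructor
    · rintro ⟨x, hx, rfl⟩ i -
      exact ⟨x i, hx i, rfl⟩
    · intro hy
      choose x hx hxy using fun i => hy i trivial
      exact ⟨x, hx, funext hxy⟩
  refine SetLike.coe_injective ((coe_cStar_eq_preimage (repTopology_pi A) _).trans ?_)
  rw [himage, closure_pi_set]
  ext x
  have h (i : ι) : x i ∈ cStar (S i) ↔ eta (A i) (x i) ∈ closure (eta (A i) '' (S i : Set _)) :=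
    Set.ext_iff.1 (coe_cStar_eq_preimage (repTopology_eq_induced_eta (A i)) (S i)) (x i)
  exact ⟨fun hx i => (h i).2 (hx i trivial), fun hx i _ => (h i).1 (hx i)⟩

/-! ### The reducing ideal and `c^*`-separated algebras. -/

section Separated

variable {A : Type u} [NonUnitalRing A] [StarRing A] [Module ℂ A] [IsScalarTower ℂ A A]
  [SMulCommClass ℂ A A] [StarModule ℂ A] [TopologicalSpace A] [IsTopologicalRing A]

/-- The limit is Hausdorff, so `{0}` is closed there and its `c^*`-closure in `A` is the kernel of
`η_A`. -/
theorem mem_reducingIdeal {a : A} : a ∈ reducingIdeal A ↔ eta A a = 0 := by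
  have h := Set.ext_iff.1
    (coe_cStar_eq_preimage (repTopology_eq_induced_eta A) (zeroSubalgebra A)) a
  rw [coe_zeroSubalgebra, Set.image_singleton, map_zero, closure_singleton] at h
  exact h

theorem alpha_injective_iff_reducingIdeal :
    Function.Injective (alpha A) ↔ reducingIdeal A = zeroSubalgebra A := by
  have h : Function.Injective (alpha A) ↔ Function.Injective (eta A) :=
    ⟨fun h a b hab => h (Subtype.ext hab), fun h a b hab => h (congrArg Subtype.val hab)⟩
  rw [h, injective_iff_map_eq_zero, SetLike.ext_iff]
  refine forall_congr' fun a => ?_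
  rw [mem_reducingIdeal]
  exact ⟨fun h => ⟨h, fun h0 => (congrArg (eta A) (h0 : a = 0)).trans (map_zero _)⟩, fun h => h.1⟩

theorem isCStarSeparated_iff_alpha_injective :
    IsCStarSeparated A ↔ Function.Injective (alpha A) := by
  have hcl : (cStar (diagonal A) : Set (A × A)) = {x | eta A x.1 = eta A x.2} := by
    have hrep := repTopology_prod A A
    refine Set.Subset.antisymm ?_ fun x hx => ?_
    · rw [coe_cStar_eq_preimage hrep]
      have hclosed : IsClosed {y : proCStar A × proCStar A | y.1 = y.2} :=
        isClosed_eq continuous_fst continuous_snd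
      refine fun x hx => closure_minimal ?_ hclosed hx
      rintro _ ⟨y, hy, rfl⟩
      exact congrArg (eta A) hy
    · rw [coe_cStar_eq_preimage hrep]
      -- A pair with equal `η`-images has the same image as the diagonal point `(x.1, x.1)`, so no
      -- limit is needed.
      refine subset_closure ⟨(x.1, x.1), rfl, ?_⟩
      exact Prod.ext rfl hx
  constructor
  · intro h a b hab
    have : (a, b) ∈ (cStar (diagonal A) : Set (A × A)) := by
      rw [hcl]
      exact congrArg Subtype.val hab
    rw [h] at this
    exact this
  · intro h
    refine SetLike.coe_injective (hcl.trans (Set.ext fun x => ?_))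
    exact ⟨fun hx => h (Subtype.ext hx), fun hx => congrArg (eta A) hx⟩

end Separated

/-! ### `c^*`-compactness against `K`-compactness of `PC^*(A)`. -/

section Compact

variable {A : Type u} [NonUnitalRing A] [StarRing A] [Module ℂ A] [IsScalarTower ℂ A A]
  [SMulCommClass ℂ A A] [StarModule ℂ A] [TopologicalSpace A]

/-- The projection of the pro-`C*` reflection to `A_p`. -/
def proEval (A : Type u) [NonUnitalRing A] [StarRing A] [Module ℂ A] [TopologicalSpace A]
    (p : CStarSeminorm A) : proCStar A →⋆ₙₐ[ℂ] Compl p :=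
  (Pi.evalNonUnitalStarAlgHom ℂ (fun p : CStarSeminorm A => Compl p) p).comp
    (NonUnitalStarSubalgebraClass.subtype (proCStar A))

theorem isPStar_proCStar : IsPStar (proCStar A) :=
  isPStar_of_isInducing (proEval A) IsInducing.subtypeVal

theorem isPStar_pcStar : IsPStar (pcStar A) :=
  isPStar_of_isInducing
    (fun p => (proEval A p).comp (NonUnitalStarSubalgebraClass.subtype (pcStar A)))
    (IsInducing.subtypeVal.comp IsInducing.subtypeVal)

/-- A `K`-compact `PC*(A)` is closed in the pro-`C*` reflection, hence is all of it. -/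
theorem eta_surjective_of_isKCompactInPStar (hA : IsKCompactInPStar (pcStar A)) :
    Function.Surjective (eta A) := by
  let ι : pcStar A →⋆ₙₐ[ℂ] proCStar A := NonUnitalStarSubalgebraClass.subtype (pcStar A)
  -- The graph of the inclusion of `PC^*(A)` is closed because the limit is Hausdorff. Its
  -- projection is `η_A(A)`, so `K`-compactness makes this dense set closed.
  let G : NonUnitalStarSubalgebra ℂ (pcStar A × proCStar A) :=
    NonUnitalStarAlgHom.range ((NonUnitalStarAlgHom.id ℂ (pcStar A)).prod ι)
  have hGset : (G : Set (pcStar A × proCStar A)) = {x | (x.1 : proCStar A) = x.2} := by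
    ext ⟨x, y⟩
    constructor
    · rintro ⟨z, hz⟩
      obtain ⟨rfl, rfl⟩ := Prod.ext_iff.1 hz
      rfl
    · intro h
      exact ⟨x, Prod.ext rfl h⟩
  have hG : IsClosed (G : Set (pcStar A × proCStar A)) := by
    rw [hGset]
    exact isClosed_eq (continuous_subtype_val.comp continuous_fst) continuous_snd
  have hsnd : Prod.snd '' (G : Set (pcStar A × proCStar A)) = Set.range (eta A) := by
    rw [hGset]
    ext y
    constructor
    · rintro ⟨x, hx, rfl⟩
      rw [← show (x.1 : proCStar A) = x.2 from hx]
      exact x.1.2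
    · intro hy
      exact ⟨(⟨y, hy⟩, y), rfl, rfl⟩
  have h := hA.2 (proCStar A) isPStar_proCStar G
  rw [hG.closure_eq, hsnd, denseRange_eta.closure_range] at h
  exact Set.range_eq_univ.1 h

variable [IsTopologicalRing A]

/-- For `B` in `P*A` the surjection `α_A × id` induces the representation topology on `A × B`.
Applying `c^*`-compactness to the preimage of `S` therefore gives the claim for `S`. -/
theorem isKCompactInPStar_pcStar (hA : IsCStarCompact A) : IsKCompactInPStar (pcStar A) := by
  refine ⟨isPStar_pcStar, ?_⟩
  intro B _ _ _ _ _ _ _ _ _ hB S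
  let Φ : A × B →⋆ₙₐ[ℂ] pcStar A × B :=
    ((alpha A).comp (NonUnitalStarAlgHom.fst ℂ A B)).prod (NonUnitalStarAlgHom.snd ℂ A B)
  have hΦ : Function.Surjective Φ := (alpha_surjective A).prodMap Function.surjective_id
  have hrep : repTopology (A × B) = TopologicalSpace.induced Φ inferInstance :=
    repTopology_prod_eq_induced (g := id) (repTopology_eq_induced_alpha A)
      (by rw [induced_id]; exact hB.1.symm)
  -- `Φ` is onto and keeps the second coordinate, so pulling back along it does not change the
  -- projection to `B`.
  have hsnd (T : Set (pcStar A × B)) : Prod.snd '' (Φ ⁻¹' T) = Prod.snd '' T := by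
    conv_rhs => rw [← Set.image_preimage_eq T hΦ, Set.image_image]
    rfl
  have h := SetLike.ext'_iff.1 (hA B (S.comap Φ))
  have h1 : ((S.comap Φ).map (NonUnitalStarAlgHom.snd ℂ A B) : Set B) =
      Prod.snd '' (S : Set (pcStar A × B)) := hsnd S
  have h2 : (cStar (S.comap Φ) : Set (A × B)) = Φ ⁻¹' closure (S : Set (pcStar A × B)) := by
    rw [coe_cStar_eq_preimage hrep]
    exact congrArg (fun T => Φ ⁻¹' closure T)
      (Set.image_preimage_eq (S : Set (pcStar A × B)) hΦ)
  rw [← hsnd, ← h2, ← h1, ← hB.coe_cStar]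
  exact h

/-- An arbitrary `B` is replaced by `PC^*(B)`, which lies in `P*A`, and `S` by its image under `α_A
× α_B`; both `c^*`-closures are preimages of closures there. -/
theorem isCStarCompact_of_isKCompactInPStar (hA : IsKCompactInPStar (pcStar A)) :
    IsCStarCompact A := by
  intro B _ _ _ _ _ _ _ _ _ S
  let Φ : A × B →⋆ₙₐ[ℂ] pcStar A × pcStar B :=
    ((alpha A).comp (NonUnitalStarAlgHom.fst ℂ A B)).prod
      ((alpha B).comp (NonUnitalStarAlgHom.snd ℂ A B))
  have hrep : repTopology (A × B) = TopologicalSpace.induced Φ inferInstance :=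
    repTopology_prod_eq_induced (repTopology_eq_induced_alpha A) (repTopology_eq_induced_alpha B)
  have h := hA.2 (pcStar B) isPStar_pcStar (S.map Φ)
  have hcl : (cStar S : Set (A × B)) = Φ ⁻¹' closure (S.map Φ : Set (pcStar A × pcStar B)) :=
    coe_cStar_eq_preimage hrep S
  have himage : alpha B '' (Prod.snd '' (S : Set (A × B))) =
      Prod.snd '' (S.map Φ : Set (pcStar A × pcStar B)) := by
    rw [NonUnitalStarSubalgebra.coe_map, Set.image_image, Set.image_image]
    rfl
  have hcl' : (cStar (S.map (NonUnitalStarAlgHom.snd ℂ A B)) : Set B) =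
      alpha B ⁻¹' (Prod.snd '' closure (S.map Φ : Set (pcStar A × pcStar B))) := by
    rw [coe_cStar_eq_preimage (repTopology_eq_induced_alpha B), h, ← himage]
    rfl
  refine SetLike.coe_injective (Eq.trans ?_ hcl'.symm)
  change Prod.snd '' (cStar S : Set (A × B)) = _
  rw [hcl]
  ext b
  constructor
  · rintro ⟨x, hx, rfl⟩
    exact ⟨Φ x, hx, rfl⟩
  -- Only the first coordinate has to be lifted. The given `b` is kept as the second, so `α_B` need
  -- not be injective.
  · rintro ⟨⟨x, y⟩, hxy, hy⟩
    obtain ⟨a, rfl⟩ := alpha_surjective A x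
    obtain rfl : y = alpha B b := hy
    exact ⟨(a, b), hxy, rfl⟩

end Compact

end

end TopStarAlg

open TopStarAlg in
theorem mainTheorem10 :
    -- (a) `c^* = K^α = K^η`
    (∀ (A : Type u) [NonUnitalRing A] [StarRing A] [Module ℂ A] [IsScalarTower ℂ A A]
      [SMulCommClass ℂ A A] [StarModule ℂ A] [TopologicalSpace A] [IsTopologicalRing A]
      [ContinuousStar A] (S : NonUnitalStarSubalgebra ℂ A),
      cStar S = liftAlpha S ∧ cStar S = liftEta S) ∧
    -- (b) `c^*` is finitely productive
    (∀ (ι : Type) [Finite ι] (A : ι → Type u) [∀ i, NonUnitalRing (A i)] [∀ i, StarRing (A i)]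
      [∀ i, Module ℂ (A i)] [∀ i, IsScalarTower ℂ (A i) (A i)] [∀ i, SMulCommClass ℂ (A i) (A i)]
      [∀ i, StarModule ℂ (A i)] [∀ i, TopologicalSpace (A i)] [∀ i, IsTopologicalRing (A i)]
      [∀ i, ContinuousStar (A i)] (S : ∀ i, NonUnitalStarSubalgebra ℂ (A i)),
      cStar (piSubalgebra S) = piSubalgebra fun i => cStar (S i)) ∧
    -- (c) `c^*`-separated algebras
    (∀ (A : Type u) [NonUnitalRing A] [StarRing A] [Module ℂ A] [IsScalarTower ℂ A A]
      [SMulCommClass ℂ A A] [StarModule ℂ A] [TopologicalSpace A] [IsTopologicalRing A]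
      [ContinuousStar A],
      (IsCStarSeparated A ↔ Function.Injective (alpha A)) ∧
      (IsCStarSeparated A ↔ reducingIdeal A = zeroSubalgebra A) ∧
      (IsPStar A → IsCStarSeparated A)) ∧
    -- (d) `c^*`-compact algebras
    (∀ (A : Type u) [NonUnitalRing A] [StarRing A] [Module ℂ A] [IsScalarTower ℂ A A]
      [SMulCommClass ℂ A A] [StarModule ℂ A] [TopologicalSpace A] [IsTopologicalRing A]
      [ContinuousStar A],
      (IsCStarCompact A ↔ IsKCompactInPStar (pcStar A)) ∧
      (IsCStarCompact A → Function.Surjective (eta A))) := by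
  refine ⟨?_, ?_, ?_, ?_⟩
  · intro A _ _ _ _ _ _ _ _ _ S
    exact ⟨cStar_eq_liftAlpha S, cStar_eq_liftEta S⟩
  · intro ι _ A _ _ _ _ _ _ _ _ _ S
    exact cStar_piSubalgebra S
  · intro A _ _ _ _ _ _ _ _ _
    have h := isCStarSeparated_iff_alpha_injective (A := A)
    have h' := h.trans alpha_injective_iff_reducingIdeal
    exact ⟨h, h', fun hA => h'.2 hA.2⟩
  · intro A _ _ _ _ _ _ _ _ _
    exact ⟨⟨isKCompactInPStar_pcStar, isCStarCompact_of_isKCompactInPStar⟩,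
      fun hA => eta_surjective_of_isKCompactInPStar (isKCompactInPStar_pcStar hA)⟩
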